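/- Let $r\ge 1$, let $\lambda=(\lambda_1\ge\cdots\ge\lambda_r\ge 0)$ be a partition, let $v\in\mathbb{C}$ and $z=(z_1,\dots,z_r)\in(\mathbb{C}^\times)^r$, and fix square roots $\sqrt v$ and $z_i^{1/2}$ (any choice; half-integral powers of $z_i$ are powers of $z_i^{1/2}$). Consider the rectangular lattice with $2r$ rows, numbered $1,\dots,2r$ from bottom to top, and $\lambda_1+r$ columns, labelled $\frac12,\frac32,\dots,\lambda_1+r-\frac12$ from right to left. Odd-numbered rows consist of $\Gamma$ ice and even-numbered rows of $\Delta$ ice; the vertices of the $i$th $\Gamma$ row (row $2i-1$) have spectral parameter $z_i^{-1}$, those of the $i$th $\Delta$ row (row $2i$) have spectral parameter $z_i$. Every edge carries a spin in $\{0,1\}$. The spins are $0$ on the left and bottom boundary edges; on the top boundary they are $1$ in the columns labelled $\lambda_i+r+\frac12-i$ $(1\le i\le r)$ and $0$ in the others; on the right boundary, rows $2i-1$ and $2i$ are joined by a cap with spectral parameter $z_i$. A vertex with spectral parameter $x$ and spins (left, top, right, bottom) equal to $(0,0,0,0)$, $(1,1,1,1)$, $(0,1,0,1)$, $(1,0,1,0)$,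 $(1,0,0,1)$, $(0,1,1,0)$ has weight $1,\ x,\ -v,\ x,\ x(1-v),\ 1$ respectively if it is $\Gamma$ ice, and $1,\ -vx,\ 1,\ x,\ x(1-v),\ 1$ respectively if it is $\Delta$ ice; all other configurations have weight $0$. The $i$th cap has weight $-\sqrt v\,z_i^{1/2}$ if its (bottom, top) spins are $(0,1)$, weight $z_i^{-1/2}$ if they are $(1,0)$, and weight $0$ otherwise. Let $Z(\mathcal{T}_{\lambda,z})$ be the partition function, that is, the sum over all assignments of spins to the edges satisfying the boundary conditions of the product of the weights of all vertices and caps. Let $B_r$ be the hyperoctahedral group, that is, the group of permutations $\sigma$ of $\{1,\bar 1,\dots,r,\bar r\}$ with $\sigma(\bar i)=\overline{\sigma(i)}$. For a rational function $f$ of $z$ put $(\sigma f)(z)=f(z_{\sigma(1)},\dots,z_{\sigma(r)})$, where $z_{\bar i}=z_i^{-1}$. Then $$Z(\mathcal{T}_{\lambda,z})=z^{-\rho_B}\prod_{i=1}^r(1-\sqrt v\,z_i)\prod_{1\le i<j\le r}(1-vz_iz_j)(1-vz_jz_i^{-1})\sum_{\sigma\in B_r}\sigma\Bigl(z^{\lambda+\rho_C}\prod_{i=1}^r(1+\sqrt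 v\,z_i^{-1})\,\Delta_C(z)^{-1}\Bigr)$$ whenever $\Delta_C(z)\neq 0$ (hence as an identity of rational functions of $\sqrt v$ and the $z_i^{1/2}$), where $\rho_B=(\frac12,\frac32,\dots,r-\frac12)$, $\rho_C=(r,r-1,\dots,1)$, and $$\Delta_C(z)=\prod_{1\le i<j\le r}\bigl(z_i^{1/2}z_j^{-1/2}-z_i^{-1/2}z_j^{1/2}\bigr)\bigl(z_i^{1/2}z_j^{1/2}-z_i^{-1/2}z_j^{-1/2}\bigr)\prod_{i=1}^r(z_i-z_i^{-1}).$$ -/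

import Mathlib

namespace UTurnIce

/-! ### Boltzmann weights -/

/-- A spin; `0` is the spin `+` and `1` is the spin `-`. -/
abbrev Spin := Fin 2

/-- Boltzmann weight of a vertex of `Γ` ice with deformation parameter `v` and spectral parameter
`z`. The spins are given in the order left, top, right, bottom; the six admissible configurations
are listed in the order `a₁, a₂, b₁, b₂, c₁, c₂`, and an inadmissible one has weight `0`. -/
def gammaWeight (v z : ℂ) : Spin → Spin → Spin → Spin → ℂ
  | 0, 0, 0, 0 => 1
  | 1, 1, 1, 1 => z
  | 0, 1, 0, 1 => -v
  | 1, 0, 1, 0 => z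
  | 1, 0, 0, 1 => z * (1 - v)
  | 0, 1, 1, 0 => 1
  | _, _, _, _ => 0

/-- Boltzmann weight of a vertex of `Δ` ice with deformation parameter `v` and spectral parameter
`z`, with the same conventions as for `Γ` ice. -/
def deltaWeight (v z : ℂ) : Spin → Spin → Spin → Spin → ℂ
  | 0, 0, 0, 0 => 1
  | 1, 1, 1, 1 => -v * z
  | 0, 1, 0, 1 => 1
  | 1, 0, 1, 0 => z
  | 1, 0, 0, 1 => z * (1 - v)
  | 0, 1, 1, 0 => 1
  | _, _, _, _ => 0

/-- Boltzmann weight of a cap vertex, where `s` is the chosen square root of the deformation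
parameter and `w` the chosen square root of the spectral parameter. The spins are given in the
order bottom edge, top edge. -/
noncomputable def capWeight (s w : ℂ) : Spin → Spin → ℂ
  | 0, 1 => -s * w
  | 1, 0 => w⁻¹
  | _, _ => 0

/-! ### The lattice model

The lattice has `2 * r` rows and `M` columns. Rows are indexed from bottom to top by `Fin (2 * r)`
and columns from right to left by `Fin M`, both starting at `0`; thus column `c` is the column
with label `c + 1/2`. In each row the `M + 1` horizontal edges are indexed from right to left, and
in each column the `2 * r + 1` vertical edges are indexed from bottom to top. -/

/-- The spins on the horizontal edges: row first, then the position counted from the right. -/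
abbrev HorSpins (r M : ℕ) := Fin (2 * r) → Fin (M + 1) → Spin

/-- The spins on the vertical edges: column first, then the position counted from the bottom. -/
abbrev VertSpins (r M : ℕ) := Fin M → Fin (2 * r + 1) → Spin

/-- The `i`-th row of `Γ` ice (the rows `1, 3, 5, …` when rows are counted from `1`). -/
def gammaRow {r : ℕ} (i : Fin r) : Fin (2 * r) := ⟨2 * i, by omega⟩

/-- The `i`-th row of `Δ` ice (the rows `2, 4, 6, …` when rows are counted from `1`). -/
def deltaRow {r : ℕ} (i : Fin r) : Fin (2 * r) := ⟨2 * i + 1, by omega⟩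

/-- Column `c` carries the spin `1` on the top boundary exactly if its label `c + 1/2` equals
`lam_k + r + 1/2 - k` for some `k` with `1 ≤ k ≤ r` (here `k = i + 1`). -/
def IsMarked {r : ℕ} (lam : Fin r → ℕ) (c : ℕ) : Prop :=
  ∃ i : Fin r, c + ((i : ℕ) + 1) = lam i + r

instance {r : ℕ} (lam : Fin r → ℕ) (c : ℕ) : Decidable (IsMarked lam c) :=
  inferInstanceAs (Decidable (∃ i : Fin r, c + ((i : ℕ) + 1) = lam i + r))

/-- The boundary conditions on the left, bottom and top boundaries. (The edges on the right
boundary are joined in pairs by the caps and are free.) -/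
def IsState {r M : ℕ} (lam : Fin r → ℕ) (h : HorSpins r M) (u : VertSpins r M) : Prop :=
  (∀ a, h a (Fin.last M) = 0) ∧
  (∀ c, u c 0 = 0) ∧
  (∀ c, u c (Fin.last (2 * r)) = if IsMarked lam c then 1 else 0)

instance {r M : ℕ} (lam : Fin r → ℕ) (h : HorSpins r M) (u : VertSpins r M) :
    Decidable (IsState lam h u) :=
  inferInstanceAs (Decidable (_ ∧ _ ∧ _))

/-- The Boltzmann weight of a labelling of the edges, as the product of the weights of all
`Γ` vertices, all `Δ` vertices and all caps. Here `s` is a square root of `v` and `w i` is a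
square root of the spectral parameter `z i`. -/
noncomputable def stateWeight {r M : ℕ} (v s : ℂ) (z w : Fin r → ℂ)
    (h : HorSpins r M) (u : VertSpins r M) : ℂ :=
  (∏ i : Fin r, ∏ c : Fin M,
    gammaWeight v (z i)⁻¹ (h (gammaRow i) c.succ) (u c (gammaRow i).succ)
      (h (gammaRow i) c.castSucc) (u c (gammaRow i).castSucc)) *
  (∏ i : Fin r, ∏ c : Fin M,
    deltaWeight v (z i) (h (deltaRow i) c.succ) (u c (deltaRow i).succ)
      (h (deltaRow i) c.castSucc) (u c (deltaRow i).castSucc)) *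
  ∏ i : Fin r, capWeight s (w i) (h (gammaRow i) 0) (h (deltaRow i) 0)

/-- The partition function of the model attached to `lam`; the lattice has `lam 0 + r` columns,
where `lam 0` is the largest part of `lam`. -/
noncomputable def partitionFunction {r : ℕ} [NeZero r] (lam : Fin r → ℕ) (v s : ℂ)
    (z w : Fin r → ℂ) : ℂ :=
  ∑ h : HorSpins r (lam 0 + r), ∑ u : VertSpins r (lam 0 + r),
    if IsState lam h u then stateWeight v s z w h u else 0

/-! ### The hyperoctahedral group -/

/-- The set `{1, 1̄, …, r, r̄}`: `Sum.inl i` is `i` and `Sum.inr i` is `ī`. -/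
abbrev SignedIndex (r : ℕ) := Fin r ⊕ Fin r

/-- The involution `i ↦ ī`. -/
def bar {r : ℕ} (x : SignedIndex r) : SignedIndex r := x.swap

/-- The hyperoctahedral group `B_r` of the permutations that commute with `bar`. -/
def hyperoctahedral (r : ℕ) : Subgroup (Equiv.Perm (SignedIndex r)) where
  carrier := {σ | ∀ x, σ (bar x) = bar (σ x)}
  one_mem' := fun _ => rfl
  mul_mem' := by
    intro σ τ hσ hτ x
    change ∀ x, _ at hσ hτ
    simp [hσ, hτ]
  inv_mem' := by
    intro σ hσ x
    change ∀ x, _ at hσ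
    rw [Equiv.Perm.inv_eq_iff_eq, hσ]
    simp

instance (r : ℕ) : DecidablePred (· ∈ hyperoctahedral r) := fun σ =>
  inferInstanceAs (Decidable (∀ x, σ (bar x) = bar (σ x)))

/-- `z` extended to signed indices by `z_ī = z_i⁻¹`. -/
noncomputable def signedExt {r : ℕ} (z : Fin r → ℂ) : SignedIndex r → ℂ :=
  Sum.elim z fun i => (z i)⁻¹

/-- `σ z = (z_{σ(1)}, …, z_{σ(r)})`. -/
noncomputable def act {r : ℕ} (σ : hyperoctahedral r) (z : Fin r → ℂ) : Fin r → ℂ :=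
  fun i => signedExt z ((σ : Equiv.Perm (SignedIndex r)) (Sum.inl i))

/-! ### The right-hand side -/

/-- The Weyl denominator of type `C`. It does not depend on the choice of the square roots, see
`weylDenomC_eq` below; the principal ones are used. -/
noncomputable def weylDenomC {r : ℕ} (z : Fin r → ℂ) : ℂ :=
  (∏ i : Fin r, ∏ j ∈ Finset.Ioi i,
    ((z i ^ (1 / 2 : ℂ) * z j ^ (-(1 / 2) : ℂ) - z i ^ (-(1 / 2) : ℂ) * z j ^ (1 / 2 : ℂ)) *
      (z i ^ (1 / 2 : ℂ) * z j ^ (1 / 2 : ℂ) - z i ^ (-(1 / 2) : ℂ) * z j ^ (-(1 / 2) : ℂ)))) *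
  ∏ i : Fin r, (z i - (z i)⁻¹)

/-- `weylDenomC` computed with arbitrary square roots `w i` of the `z i`. -/
theorem weylDenomC_eq {r : ℕ} (z w : Fin r → ℂ) (hz : ∀ i, z i ≠ 0) (hw : ∀ i, w i ^ 2 = z i) :
    weylDenomC z =
      (∏ i : Fin r, ∏ j ∈ Finset.Ioi i,
        ((w i * (w j)⁻¹ - (w i)⁻¹ * w j) * (w i * w j - (w i)⁻¹ * (w j)⁻¹))) *
      ∏ i : Fin r, (z i - (z i)⁻¹) := by
  have key : ∀ a b : ℂ, a ≠ 0 → b ≠ 0 →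
      (a * b⁻¹ - a⁻¹ * b) * (a * b - a⁻¹ * b⁻¹) =
        a ^ 2 + (a ^ 2)⁻¹ - (b ^ 2 + (b ^ 2)⁻¹) := by
    intro a b ha hb
    field_simp
    ring
  have hne : ∀ i, w i ≠ 0 := fun i h => hz i (by rw [← hw i, h]; simp)
  have hsq : ∀ i, (z i ^ (1 / 2 : ℂ)) ^ 2 = z i := fun i => by
    rw [← Complex.cpow_nat_mul]; norm_num
  have hne' : ∀ i, z i ^ (1 / 2 : ℂ) ≠ 0 := fun i h => hz i (by rw [← hsq i, h]; simp)
  unfold weylDenomC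
  congr 1
  refine Finset.prod_congr rfl fun i _ => Finset.prod_congr rfl fun j _ => ?_
  rw [Complex.cpow_neg, Complex.cpow_neg, key _ _ (hne' i) (hne' j), key _ _ (hne i) (hne j),
    hsq, hsq, hw, hw]

/-- The function `z^{λ + ρ_C} ∏ᵢ (1 + √v zᵢ⁻¹) Δ_C(z)⁻¹` with `ρ_C = (r, r - 1, …, 1)`, where `s`
is the chosen square root of `v`; as the indices start at `0`, the exponent of `z i` is
`lam i + (r - i)`. -/
noncomputable def summand {r : ℕ} (lam : Fin r → ℕ) (s : ℂ) (z : Fin r → ℂ) : ℂ :=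
  (∏ i : Fin r, z i ^ (lam i + (r - (i : ℕ)))) * (∏ i : Fin r, (1 + s * (z i)⁻¹)) *
    (weylDenomC z)⁻¹

end UTurnIce

namespace UTurnIce

open ExteriorAlgebra

/-! Both kinds of ice are free-fermionic: `a₁ a₂ + b₁ b₂ = c₁ c₂` with `a₁ = c₂ = 1`. Hence the
weights only describe a linear one-particle evolution, and many-particle states are exterior
products. Attach a vector to each right boundary edge and multiply the vectors of the occupied
edges. A row then amounts to replacing the vectors on its bottom edges by those of `rowSeq`
(`rowVec_iceWeight`), so `n` rows give the product of the vectors `rowsSeq` over the marked top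
columns (`latticeVec_iceWeight`).

Give the two edges of the `i`th cap multiples of the unit vector `eᵢ`, with the cap weights as
coefficients. The top-degree coefficient in the exterior algebra of `ℂ^r` then keeps exactly the
states with one occupied edge per cap, and the partition function is an `r × r` determinant
(`partitionFunction_eq_det`).

Each coordinate of its entries is a scalar sequence in the column index. A `Γ`–`Δ` double row with
parameter `z` sends `capSeq s y` to an eigenvalue times itself plus a multiple of `capSeq s z`, and
its cap creates a multiple of `capSeq s z` from nothing (`doubleRow_capSeq`, `doubleRow_zero`). The
matrix is therefore (values of `capSeq` at the `z i`) times a triangular matrix. The diagonal of the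
latter gives the product prefactor, up to factors that go into the Weyl denominator. The remaining
determinant, expanded over signed permutations, is the sum over `B_r` (`sum_summand_act`), since
`Δ_C` is alternating (`weylDenomC_act`). -/

/-- The free-fermionic vertex weights with `a₁ = c₂ = 1`, `b₁ = b`, `b₂ = x`, `c₁ = x (1 - v)` and
`a₂ = c₁ c₂ - b₁ b₂`. -/
def iceWeight (v b x : ℂ) : Spin → Spin → Spin → Spin → ℂ
  | 0, 0, 0, 0 => 1
  | 1, 1, 1, 1 => x * (1 - v) - b * x
  | 0, 1, 0, 1 => b
  | 1, 0, 1, 0 => x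
  | 1, 0, 0, 1 => x * (1 - v)
  | 0, 1, 1, 0 => 1
  | _, _, _, _ => 0

theorem gammaWeight_eq_iceWeight (v x : ℂ) : gammaWeight v x = iceWeight v (-v) x := by
  funext l t r b
  fin_cases l <;> fin_cases t <;> fin_cases r <;> fin_cases b <;>
    simp [gammaWeight, iceWeight]
  ring

theorem deltaWeight_eq_iceWeight (v x : ℂ) : deltaWeight v x = iceWeight v 1 x := by
  funext l t r b
  fin_cases l <;> fin_cases t <;> fin_cases r <;> fin_cases b <;>
    simp [deltaWeight, iceWeight]
  ring

/-! ### One row of ice in the exterior algebra. -/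

section Rows

variable {F : Type*} [AddCommGroup F] [Module ℂ F]

/-- The vector carried by a horizontal edge with spin `1` entering column `c - 1` of a row from the
left, when the bottom edge of column `c` carries `p c` and the right boundary edge carries `e`. -/
def lineSeq (v x : ℂ) (e : F) (p : ℕ → F) : ℕ → F
  | 0 => e
  | c + 1 => (x * (1 - v)) • p c + x • lineSeq v x e p c

/-- The vector carried by the top edge of column `c` of a row. -/
def rowSeq (v b x : ℂ) (e : F) (p : ℕ → F) (c : ℕ) : F :=
  b • p c + lineSeq v x e p c

/-- The product, from left to right, of the vectors `p c` over the columns with spin `1`. -/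
noncomputable def occProd (p : ℕ → F) {M : ℕ} (t : Fin M → Spin) : ExteriorAlgebra ℂ F :=
  (List.ofFn fun c : Fin M => ι ℂ (p c) ^ (t c : ℕ)).reverse.prod

theorem occProd_succ (p : ℕ → F) {M : ℕ} (t : Fin (M + 1) → Spin) :
    occProd p t =
      ι ℂ (p M) ^ (t (Fin.last M) : ℕ) * occProd p (fun c : Fin M => t c.castSucc) := by
  rw [occProd, List.ofFn_succ', List.concat_eq_append]
  simp [occProd]

/-- The generating function of the states of a single row with top boundary `t` and left boundary
spin `k`. -/
noncomputable def rowVec (W : Spin → Spin → Spin → Spin → ℂ) (e : F) (p : ℕ → F) {M : ℕ}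
    (t : Fin M → Spin) (k : Spin) : ExteriorAlgebra ℂ F :=
  ∑ h : Fin (M + 1) → Spin, ∑ b : Fin M → Spin,
    if h (Fin.last M) = k then
      (∏ c : Fin M, W (h c.succ) (t c) (h c.castSucc) (b c)) •
        (occProd p b * ι ℂ e ^ (h 0 : ℕ))
    else 0

theorem rowVec_succ (W : Spin → Spin → Spin → Spin → ℂ) (e : F) (p : ℕ → F) {M : ℕ}
    (t : Fin (M + 1) → Spin) (k : Spin) :
    rowVec W e p t k = ∑ l : Spin, ∑ β : Spin, W k (t (Fin.last M)) l β •
      (ι ℂ (p M) ^ (β : ℕ) * rowVec W e p (fun c : Fin M => t c.castSucc) l) := by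
  have hr : ∀ f : Spin → Spin → (Fin (M + 1) → Spin) → (Fin M → Spin) → ExteriorAlgebra ℂ F,
      (∑ l, ∑ β, ∑ h, ∑ b, if h (Fin.last M) = l then f l β h b else 0) =
        ∑ h, ∑ β, ∑ b, f (h (Fin.last M)) β h b := by
    intro f
    rw [Finset.sum_comm' (t' := Finset.univ) (s' := fun _ => Finset.univ) (by simp)]
    rw [Finset.sum_comm (s := (Finset.univ : Finset (Fin (M + 1) → Spin)))]
    refine Finset.sum_congr rfl fun β _ => ?_
    rw [Finset.sum_comm]
    refine Finset.sum_congr rfl fun h _ => ?_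
    rw [Finset.sum_comm]
    simp
  have h0 : ∀ (a : Spin) (h : Fin (M + 1) → Spin),
      (Fin.snoc (α := fun _ => Spin) h a : Fin (M + 2) → Spin) 0 = h 0 := fun a h => by
    rw [← Fin.castSucc_zero, Fin.snoc_castSucc]
  unfold rowVec
  simp_rw [Finset.mul_sum, Finset.smul_sum, mul_ite, mul_zero, smul_ite, smul_zero]
  rw [hr, ← (Fin.snocEquiv (fun _ : Fin (M + 2) => Spin)).sum_comp, Fintype.sum_prod_type]
  simp only [Fin.snocEquiv, Equiv.coe_fn_mk, Fin.snoc_last, h0]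
  rw [Finset.sum_eq_single k (by intro b _ hb; simp [hb]) (by simp)]
  refine Finset.sum_congr rfl fun h _ => ?_
  rw [← (Fin.snocEquiv (fun _ : Fin (M + 1) => Spin)).sum_comp, Fintype.sum_prod_type]
  simp only [Fin.snocEquiv, Equiv.coe_fn_mk, Fin.snoc_last, Fin.snoc_castSucc, occProd_succ,
    Fin.prod_univ_castSucc, Fin.succ_last, ← Fin.castSucc_succ, if_true]
  refine Finset.sum_congr rfl fun β _ => Finset.sum_congr rfl fun b _ => ?_
  rw [mul_smul_comm, smul_smul, mul_comm (W _ _ _ _), mul_assoc]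

theorem ι_mul_ι_swap (a b : F) : ι ℂ a * ι ℂ b = -(ι ℂ b * ι ℂ a) :=
  eq_neg_of_add_eq_zero_left (ι_add_mul_swap a b)

/-- A row of free-fermionic ice acts on products of vectors by `rowSeq`. -/
theorem rowVec_iceWeight (v b x : ℂ) (e : F) (p : ℕ → F) {M : ℕ} (t : Fin M → Spin) (k : Spin) :
    rowVec (iceWeight v b x) e p t k =
      ι ℂ (lineSeq v x e p M) ^ (k : ℕ) * occProd (rowSeq v b x e p) t := by
  induction M generalizing k with
  | zero =>
    unfold rowVec
    rw [← (Equiv.funUnique (Fin 1) Spin).symm.sum_comp]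
    simp [occProd, lineSeq, Fin.last]
  | succ M ih =>
    rw [rowVec_succ, occProd_succ]
    simp only [ih]
    generalize t (Fin.last M) = τ
    generalize occProd (rowSeq v b x e p) (fun c : Fin M => t c.castSucc) = P
    have hsq : ι ℂ (p M) * ι ℂ (p M) = 0 := ι_sq_zero _
    have hsq' : ι ℂ (lineSeq v x e p M) * ι ℂ (lineSeq v x e p M) = 0 := ι_sq_zero _
    have hswap := ι_mul_ι_swap (lineSeq v x e p M) (p M)
    simp only [rowSeq, lineSeq, map_add, map_smul, Fin.sum_univ_two]
    generalize ι ℂ (p M) = A at *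
    generalize ι ℂ (lineSeq v x e p M) = Y at *
    fin_cases k <;> fin_cases τ <;>
      simp [iceWeight, add_mul, mul_add, smul_smul, ← mul_assoc, hsq, hsq', hswap]
    -- Only the case of left and top spins both `1` is left. There `Y * A = -(A * Y)` and the
    -- vanishing squares leave `A * Y` with coefficient `x (1 - v) - b x`, the weight `a₂`; this is
    -- the free-fermion condition.
    module

end Rows

/-! ### Stacking rows. -/

section Lattice

variable {F : Type*} [AddCommGroup F] [Module ℂ F]

/-- The vectors carried by the top edges of the first `n` rows. -/
def rowsSeq (v : ℂ) (b x : ℕ → ℂ) (e : ℕ → F) : ℕ → ℕ → F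
  | 0 => 0
  | n + 1 => rowSeq v (b n) (x n) (e n) (rowsSeq v b x e n)

/-- The generating function of the states of `n` rows with empty left and bottom boundaries and
top boundary `t`. -/
noncomputable def latticeVec (W : ℕ → Spin → Spin → Spin → Spin → ℂ) (e : ℕ → F) (n : ℕ) {M : ℕ}
    (t : Fin M → Spin) : ExteriorAlgebra ℂ F :=
  ∑ h : Fin n → Fin (M + 1) → Spin, ∑ u : Fin (n + 1) → Fin M → Spin,
    if (∀ a, h a (Fin.last M) = 0) ∧ u 0 = 0 ∧ u (Fin.last n) = t then
      (∏ a : Fin n, ∏ c : Fin M,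
        W a (h a c.succ) (u a.succ c) (h a c.castSucc) (u a.castSucc c)) •
        (List.ofFn fun a : Fin n => ι ℂ (e a) ^ (h a 0 : ℕ)).prod
    else 0

theorem latticeVec_succ (W : ℕ → Spin → Spin → Spin → Spin → ℂ) (e : ℕ → F) (n : ℕ) {M : ℕ}
    (t : Fin M → Spin) :
    latticeVec W e (n + 1) t = ∑ h : Fin (M + 1) → Spin, ∑ b : Fin M → Spin,
      if h (Fin.last M) = 0 then
        (∏ c : Fin M, W n (h c.succ) (t c) (h c.castSucc) (b c)) •
          (latticeVec W e n b * ι ℂ (e n) ^ (h 0 : ℕ))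
      else 0 := by
  have h0 : ∀ (a : Fin M → Spin) (u : Fin (n + 1) → Fin M → Spin),
      (Fin.snoc (α := fun _ => Fin M → Spin) u a : Fin (n + 2) → Fin M → Spin) 0 = u 0 :=
    fun a h => by rw [← Fin.castSucc_zero, Fin.snoc_castSucc]
  have hr : ∀ f : (Fin n → Fin (M + 1) → Spin) → (Fin (n + 1) → Fin M → Spin) →
      (Fin M → Spin) → ExteriorAlgebra ℂ F,
      (∑ b, ∑ h, ∑ u, if u (Fin.last n) = b then f h u b else 0) =
        ∑ h, ∑ u, f h u (u (Fin.last n)) := by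
    intro f
    rw [Finset.sum_comm]
    refine Finset.sum_congr rfl fun h _ => ?_
    rw [Finset.sum_comm]
    simp
  unfold latticeVec
  rw [← (Fin.snocEquiv (fun _ : Fin (n + 1) => Fin (M + 1) → Spin)).sum_comp,
    Fintype.sum_prod_type]
  refine Finset.sum_congr rfl fun h _ => ?_
  simp only [Fin.snocEquiv, Equiv.coe_fn_mk]
  by_cases hk : h (Fin.last M) = 0
  swap
  · simp [hk, Fin.forall_fin_succ']
  simp only [hk, if_true, Finset.sum_mul, Finset.smul_sum]
  have hc : ∀ (h' : Fin n → Fin (M + 1) → Spin) (u : Fin (n + 1) → Fin M → Spin)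
      (b : Fin M → Spin) (A : ExteriorAlgebra ℂ F),
      (if (∀ a, h' a (Fin.last M) = 0) ∧ u 0 = 0 ∧ u (Fin.last n) = b then A else 0) =
      if u (Fin.last n) = b then
        if (∀ a, h' a (Fin.last M) = 0) ∧ u 0 = 0 then A else 0 else 0 := by
    intro h' u b A
    split_ifs <;> tauto
  simp_rw [hc, ite_mul, zero_mul, smul_ite, smul_zero]
  rw [hr]
  refine Finset.sum_congr rfl fun h' _ => ?_
  rw [← (Fin.snocEquiv (fun _ : Fin (n + 2) => Fin M → Spin)).sum_comp, Fintype.sum_prod_type]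
  simp only [Fin.snocEquiv, Equiv.coe_fn_mk, Fin.snoc_last, h0]
  rw [Finset.sum_eq_single t (by intro b _ hb; simp [hb]) (by simp)]
  refine Finset.sum_congr rfl fun u _ => ?_
  have hiff : (∀ a, (Fin.snoc (α := fun _ => Fin (M + 1) → Spin) h' h :
      Fin (n + 1) → Fin (M + 1) → Spin) a (Fin.last M) = 0) ↔ ∀ a, h' a (Fin.last M) = 0 := by
    simp [Fin.forall_fin_succ', hk]
  refine if_congr (by rw [hiff]; simp) ?_ rfl
  rw [List.ofFn_succ', List.concat_eq_append]
  simp only [Fin.prod_univ_castSucc, Fin.snoc_last, Fin.snoc_castSucc, Fin.succ_last,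
    ← Fin.castSucc_succ, List.prod_append, List.prod_singleton, Fin.val_castSucc, Fin.val_last]
  rw [smul_mul_assoc, smul_smul, mul_comm]

theorem occProd_zero {M : ℕ} (t : Fin M → Spin) :
    occProd (0 : ℕ → F) t = if t = 0 then 1 else 0 := by
  induction M with
  | zero => simp [occProd, Subsingleton.elim t 0]
  | succ M ih =>
    rw [occProd_succ, ih]
    have hiff : t = 0 ↔ (fun c : Fin M => t c.castSucc) = 0 ∧ t (Fin.last M) = 0 := by
      simp [funext_iff, Fin.forall_fin_succ']
    rcases Fin.exists_fin_two.mp ⟨t (Fin.last M), rfl⟩ with h | h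
    · simp [hiff, h]
    · simp [hiff, h]

/-- The one-row statement is iterated from the bottom. Left boundary spin `0` removes the `lineSeq`
factor, and the empty bottom boundary corresponds to the zero sequence, whose product is nonzero
only when nothing is occupied. -/
theorem latticeVec_iceWeight (v : ℂ) (b x : ℕ → ℂ) (e : ℕ → F) (n : ℕ) {M : ℕ}
    (t : Fin M → Spin) :
    latticeVec (fun a => iceWeight v (b a) (x a)) e n t = occProd (rowsSeq v b x e n) t := by
  induction n generalizing t with
  | zero =>
    rw [rowsSeq, occProd_zero, latticeVec, Fintype.sum_unique,
      ← (Equiv.funUnique (Fin 1) (Fin M → Spin)).symm.sum_comp]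
    by_cases h : t = 0
    · subst h
      rw [Finset.sum_eq_single 0] <;> simp +contextual [Fin.last]
    · rw [if_neg h]
      refine Finset.sum_eq_zero fun u _ => if_neg ?_
      rintro ⟨-, h1, h2⟩
      exact h (h2.symm.trans h1)
  | succ n ih =>
    rw [latticeVec_succ]
    simp_rw [ih]
    simpa [rowVec, rowsSeq] using
      rowVec_iceWeight v (b n) (x n) (e n) (rowsSeq v b x e n) t 0

end Lattice

/-! ### The partition function as a determinant. -/

theorem prod_map_ite_one {α β : Type*} [Monoid β] (P : α → Prop) [DecidablePred P] (g : α → β)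
    (l : List α) : (l.map fun a => if P a then g a else 1).prod = ((l.filter P).map g).prod := by
  induction l with
  | nil => simp
  | cons a l ih => by_cases h : P a <;> simp [h, ih]

theorem filter_reverse_range_eq_ofFn {r M : ℕ} (c : Fin r → ℕ) (hc : StrictAnti c)
    (hM : ∀ i, c i < M) :
    (List.range M).reverse.filter (fun a => ∃ i, c i = a) = List.ofFn c := by
  have h1 : ((List.range M).reverse.filter (fun a => ∃ i, c i = a)).Pairwise (· > ·) := by
    refine List.Pairwise.filter _ ?_
    rw [List.pairwise_reverse]
    exact List.pairwise_lt_range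
  have h2 : (List.ofFn c).Pairwise (· > ·) := by
    rw [List.pairwise_ofFn]
    exact fun i j hij => hc hij
  refine List.Perm.eq_of_pairwise (le := (· > ·)) (fun a b _ _ h h' => absurd h (by omega))
    h1 h2 ?_
  rw [List.perm_ext_iff_of_nodup (h1.imp fun h => h.ne') (h2.imp fun h => h.ne')]
  intro a
  simp only [List.mem_filter, List.mem_reverse, List.mem_range, decide_eq_true_eq, List.mem_ofFn]
  constructor
  · exact fun h => h.2
  · rintro ⟨i, rfl⟩
    exact ⟨hM i, i, rfl⟩

theorem occProd_indicator {F : Type*} [AddCommGroup F] [Module ℂ F] (p : ℕ → F) {r M : ℕ}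
    (c : Fin r → ℕ) (hc : StrictAnti c) (hM : ∀ i, c i < M) :
    occProd p (fun a : Fin M => if ∃ i, c i = a then 1 else 0) =
      ιMulti ℂ r fun i => p (c i) := by
  have h : (List.ofFn fun a : Fin M => ι ℂ (p a) ^
      (((if ∃ i, c i = a then 1 else 0 : Spin)) : ℕ)) =
      (List.range M).map fun a => if ∃ i, c i = a then ι ℂ (p a) else 1 := by
    rw [← List.map_coe_finRange_eq_range, List.map_map, List.ofFn_eq_map]
    refine List.map_congr_left fun a _ => ?_
    by_cases h : ∃ i, c i = a <;> simp [h]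
  rw [occProd, h, ← List.map_reverse, prod_map_ite_one, filter_reverse_range_eq_ofFn c hc hM,
    ιMulti_apply, List.map_ofFn]
  rfl

/-- The linear functional extracting the top-degree part of the exterior algebra of `ℂ^r`. -/
noncomputable def topCoeff (r : ℕ) : ExteriorAlgebra ℂ (Fin r → ℂ) →ₗ[ℂ] ℂ :=
  liftAlternating (Function.update (fun _ => 0) r Matrix.detRowAlternating)

theorem topCoeff_ιMulti {r : ℕ} (m : Fin r → Fin r → ℂ) :
    topCoeff r (ιMulti ℂ r m) = Matrix.det (Matrix.of m) := by
  rw [topCoeff, liftAlternating_apply_ιMulti, Function.update_self]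
  rfl

theorem topCoeff_eq_zero_of_mem {r n : ℕ} (h : n ≠ r) {x : ExteriorAlgebra ℂ (Fin r → ℂ)}
    (hx : x ∈ ⋀[ℂ]^n (Fin r → ℂ)) : topCoeff r x = 0 := by
  rw [← ιMulti_span_fixedDegree] at hx
  induction hx using Submodule.span_induction with
  | mem x hx =>
    obtain ⟨m, rfl⟩ := hx
    rw [topCoeff, liftAlternating_apply_ιMulti, Function.update_of_ne h]
    rfl
  | zero => simp
  | add x y _ _ hx hy => rw [map_add, hx, hy, add_zero]
  | smul a x _ hx => rw [map_smul, hx, smul_zero]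

theorem ι_pow_mem_exteriorPower {F : Type*} [AddCommGroup F] [Module ℂ F] (x : F) (n : ℕ) :
    ι ℂ x ^ n ∈ ⋀[ℂ]^n F :=
  Submodule.pow_mem_pow _ (LinearMap.mem_range_self _ _) _

/-- This is how caps arise from exterior algebra. One occupied edge in every pair gives a diagonal
determinant. A doubly occupied pair gives a product of two collinear vectors, hence `0`; failing
that, an empty pair leaves the degree below `r`. -/
theorem topCoeff_prod_pairs {r : ℕ} (α β : Fin r → ℂ) (a a' : Fin r → Spin) :
    topCoeff r (List.ofFn fun i => ι ℂ (α i • (Pi.single i 1 : Fin r → ℂ)) ^ (a i : ℕ) *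
      ι ℂ (β i • (Pi.single i 1 : Fin r → ℂ)) ^ (a' i : ℕ)).prod =
      ∏ i, if a i = a' i then 0 else if a i = 1 then α i else β i := by
  have spin : ∀ k : Spin, k = 0 ∨ k = 1 := by decide
  by_cases H : ∀ i, a i ≠ a' i
  · have hterm : ∀ i, ι ℂ (α i • (Pi.single i 1 : Fin r → ℂ)) ^ (a i : ℕ) *
        ι ℂ (β i • (Pi.single i 1 : Fin r → ℂ)) ^ (a' i : ℕ) =
        ι ℂ ((if a i = 1 then α i else β i) • (Pi.single i 1 : Fin r → ℂ)) := by
      intro i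
      have := H i
      rcases spin (a i) with h | h <;> rcases spin (a' i) with h' | h' <;> simp_all
    simp_rw [hterm, if_neg (H _)]
    rw [← ιMulti_apply, topCoeff_ιMulti, ← Matrix.det_diagonal]
    congr 1
    ext i j
    by_cases h : i = j
    · subst h
      simp only [Matrix.of_apply, Matrix.diagonal_apply_eq]
      split_ifs <;> simp
    · simp only [Matrix.of_apply, Matrix.diagonal_apply_ne _ h]
      split_ifs <;> simp [Ne.symm h]
  · push Not at H
    obtain ⟨i₀, hi₀⟩ := H
    have hzero : (∏ i, if a i = a' i then 0 else if a i = 1 then α i else β i) = 0 :=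
      Finset.prod_eq_zero (Finset.mem_univ i₀) (if_pos hi₀)
    rw [hzero]
    by_cases H1 : ∃ i, a i = 1 ∧ a' i = 1
    · obtain ⟨i, h, h'⟩ := H1
      rw [List.prod_eq_zero, map_zero]
      refine List.mem_ofFn.mpr ?_
      refine ⟨i, ?_⟩
      simp [h, h']
    · refine topCoeff_eq_zero_of_mem (n := (List.ofFn fun i => (a i : ℕ) + (a' i : ℕ)).sum) ?_
        (SetLike.list_prod_ofFn_mem_graded _ _ fun i =>
          SetLike.GradedMul.mul_mem (ι_pow_mem_exteriorPower _ _) (ι_pow_mem_exteriorPower _ _))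
      rw [List.sum_ofFn]
      have hle : ∀ i, (a i : ℕ) + (a' i : ℕ) ≤ 1 := by
        intro i
        by_contra h
        exact H1 ⟨i, Fin.ext (by simp; omega), Fin.ext (by simp; omega)⟩
      have hlt : (a i₀ : ℕ) + (a' i₀ : ℕ) < 1 := by
        have := hle i₀
        rw [hi₀] at this ⊢
        omega
      have := Finset.sum_lt_sum (fun i _ => hle i) ⟨i₀, Finset.mem_univ i₀, hlt⟩
      simp at this
      omega

theorem prod_fin_two_mul {β : Type*} [CommMonoid β] {r : ℕ} (g : Fin (2 * r) → β) :
    ∏ a, g a = ∏ i : Fin r, (g (gammaRow i) * g (deltaRow i)) := by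
  rw [← List.prod_ofFn, ← List.prod_ofFn, List.ofFn_mul', List.prod_flatten, List.map_ofFn]
  congr 2
  funext i
  simp [gammaRow, deltaRow]

theorem list_prod_fin_two_mul {β : Type*} [Monoid β] {r : ℕ} (g : Fin (2 * r) → β) :
    (List.ofFn g).prod = (List.ofFn fun i : Fin r => g (gammaRow i) * g (deltaRow i)).prod := by
  rw [List.ofFn_mul', List.prod_flatten, List.map_ofFn]
  congr 2
  funext i
  simp [gammaRow, deltaRow]

/-- Extension of a finite family by zero. -/
def extendNat {r : ℕ} (z : Fin r → ℂ) (k : ℕ) : ℂ := if h : k < r then z ⟨k, h⟩ else 0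

theorem extendNat_val {r : ℕ} (z : Fin r → ℂ) (i : Fin r) : extendNat z i = z i := by
  simp [extendNat]

/-- The weight `b₁` in the `a`-th row. -/
def rowB (v : ℂ) (a : ℕ) : ℂ := if a % 2 = 0 then -v else 1

/-- The spectral parameter of the `a`-th row. -/
noncomputable def rowX {r : ℕ} (z : Fin r → ℂ) (a : ℕ) : ℂ :=
  if a % 2 = 0 then (extendNat z (a / 2))⁻¹ else extendNat z (a / 2)

/-- The `k`-th unit vector. -/
def unitVec (r k : ℕ) : Fin r → ℂ := fun j => if (j : ℕ) = k then 1 else 0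

/-- The vector carried by the right boundary edge of the `a`-th row. -/
noncomputable def rowE {r : ℕ} (s : ℂ) (w : Fin r → ℂ) (a : ℕ) : Fin r → ℂ :=
  (if a % 2 = 0 then (extendNat w (a / 2))⁻¹ else -s * extendNat w (a / 2)) • unitVec r (a / 2)

theorem unitVec_val {r : ℕ} (i : Fin r) : unitVec r i = Pi.single i 1 := by
  funext j
  simp [unitVec, Pi.single_apply, Fin.ext_iff]

theorem gammaRow_val {r : ℕ} (i : Fin r) : (gammaRow i : ℕ) = 2 * i := rfl

theorem deltaRow_val {r : ℕ} (i : Fin r) : (deltaRow i : ℕ) = 2 * i + 1 := rfl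

theorem capWeight_eq_ite (s w : ℂ) (a b : Spin) :
    capWeight s w a b = if a = b then 0 else if a = 1 then w⁻¹ else -s * w := by
  fin_cases a <;> fin_cases b <;> simp [capWeight]

/-- The partition function as a determinant. -/
theorem partitionFunction_eq_det {r : ℕ} [NeZero r] (lam : Fin r → ℕ) (hlam : Antitone lam)
    (v s : ℂ) (z w : Fin r → ℂ) :
    partitionFunction lam v s z w =
      Matrix.det (Matrix.of fun m : Fin r =>
        rowsSeq v (rowB v) (rowX z) (rowE s w) (2 * r) (lam m + r - (m + 1))) := by
  have hanti : StrictAnti fun m : Fin r => lam m + r - (m + 1) := by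
    intro i j hij
    have h1 := hlam hij.le
    have h2 : (i : ℕ) < j := hij
    have h3 := j.isLt
    change lam j + r - (j + 1) < lam i + r - (i + 1)
    omega
  have hlt : ∀ m : Fin r, lam m + r - (m + 1) < lam 0 + r := by
    intro m
    have h1 := hlam (Fin.zero_le m)
    have h3 := m.isLt
    omega
  have hmark : ∀ c : ℕ, IsMarked lam c ↔ ∃ m : Fin r, lam m + r - (m + 1) = c := by
    intro c
    refine exists_congr fun m => ?_
    have h3 := m.isLt
    omega
  rw [← topCoeff_ιMulti, ← occProd_indicator _ _ hanti hlt, ← latticeVec_iceWeight, latticeVec,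
    partitionFunction, map_sum]
  refine Finset.sum_congr rfl fun h _ => ?_
  -- The model indexes vertical spins by column and then height; `latticeVec` uses the opposite
  -- order.
  rw [← (Equiv.piComm (fun (_ : Fin (2 * r + 1)) (_ : Fin (lam 0 + r)) => Spin)).sum_comp, map_sum]
  refine Finset.sum_congr rfl fun u _ => ?_
  rw [apply_ite (topCoeff r), map_zero]
  refine if_congr ?_ ?_ rfl
  · simp only [IsState, funext_iff, hmark]
    rfl
  · rw [map_smul, list_prod_fin_two_mul, prod_fin_two_mul, Finset.prod_mul_distrib, stateWeight,
      smul_eq_mul]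
    have hg : ∀ i : Fin r, 2 * (i : ℕ) % 2 = 0 := by intro i; omega
    have hd : ∀ i : Fin r, (2 * (i : ℕ) + 1) % 2 ≠ 0 := by intro i; omega
    have hg' : ∀ i : Fin r, 2 * (i : ℕ) / 2 = i := by intro i; omega
    have hd' : ∀ i : Fin r, (2 * (i : ℕ) + 1) / 2 = i := by intro i; omega
    simp only [rowE, rowB, rowX, gammaRow_val, deltaRow_val, hg, hd, hg', hd', if_true, if_false,
      extendNat_val, unitVec_val, topCoeff_prod_pairs, capWeight_eq_ite, gammaWeight_eq_iceWeight,
      deltaWeight_eq_iceWeight]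
    rfl

/-! ### Scalar sequences and double rows. -/

theorem lineSeq_apply {r : ℕ} (v x : ℂ) (e : Fin r → ℂ) (p : ℕ → Fin r → ℂ) (c : ℕ) (j : Fin r) :
    lineSeq v x e p c j = lineSeq v x (e j) (fun c => p c j) c := by
  induction c with
  | zero => rfl
  | succ c ih => simp [lineSeq, ih]

theorem rowSeq_apply {r : ℕ} (v b x : ℂ) (e : Fin r → ℂ) (p : ℕ → Fin r → ℂ) (c : ℕ)
    (j : Fin r) : rowSeq v b x e p c j = rowSeq v b x (e j) (fun c => p c j) c := by
  simp [rowSeq, lineSeq_apply]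

theorem lineSeq_add (v x e e' : ℂ) (p p' : ℕ → ℂ) (c : ℕ) :
    lineSeq v x (e + e') (fun c => p c + p' c) c = lineSeq v x e p c + lineSeq v x e' p' c := by
  induction c with
  | zero => rfl
  | succ c ih =>
    simp only [lineSeq, ih, smul_eq_mul]
    ring

theorem lineSeq_sum {α : Type*} (S : Finset α) (v x : ℂ) (l e : α → ℂ) (p : α → ℕ → ℂ) (c : ℕ) :
    lineSeq v x (∑ i ∈ S, l i * e i) (fun c => ∑ i ∈ S, l i * p i c) c =
      ∑ i ∈ S, l i * lineSeq v x (e i) (p i) c := by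
  induction c with
  | zero => rfl
  | succ c ih =>
    simp only [lineSeq, ih, smul_eq_mul, Finset.mul_sum, ← Finset.sum_add_distrib]
    exact Finset.sum_congr rfl fun i _ => by ring

theorem rowSeq_add (v b x e e' : ℂ) (p p' : ℕ → ℂ) :
    rowSeq v b x (e + e') (fun c => p c + p' c) =
      fun c => rowSeq v b x e p c + rowSeq v b x e' p' c := by
  funext c
  simp only [rowSeq, lineSeq_add, smul_eq_mul]
  ring

theorem rowSeq_sum {α : Type*} (S : Finset α) (v b x : ℂ) (l e : α → ℂ) (p : α → ℕ → ℂ) :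
    rowSeq v b x (∑ i ∈ S, l i * e i) (fun c => ∑ i ∈ S, l i * p i c) =
      fun c => ∑ i ∈ S, l i * rowSeq v b x (e i) (p i) c := by
  funext c
  simp only [rowSeq, lineSeq_sum, smul_eq_mul, Finset.mul_sum, ← Finset.sum_add_distrib]
  exact Finset.sum_congr rfl fun i _ => by ring

theorem rowSeq_zero (v b x : ℂ) : rowSeq v b x (0 : ℂ) 0 = 0 := by
  have h : ∀ c, lineSeq v x (0 : ℂ) 0 c = 0 := fun c => by
    induction c with
    | zero => rfl
    | succ c ih => simp [lineSeq, ih]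
  funext c
  simp [rowSeq, h]

/-- The effect of a row of `Γ` ice and a row of `Δ` ice joined by a cap on scalar sequences. -/
noncomputable def doubleRow (v z e e' : ℂ) (p : ℕ → ℂ) : ℕ → ℂ :=
  rowSeq v 1 z e' (rowSeq v (-v) z⁻¹ e p)

theorem doubleRow_add_sum {α : Type*} (S : Finset α) (v z e e' : ℂ) (l : α → ℂ)
    (p : α → ℕ → ℂ) (c : ℕ) :
    doubleRow v z e e' (fun c => ∑ i ∈ S, l i * p i c) c =
      (∑ i ∈ S, l i * doubleRow v z 0 0 (p i) c) + doubleRow v z e e' 0 c := by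
  have h1 := rowSeq_add v (-v) z⁻¹ (∑ i ∈ S, l i * 0) e (fun c => ∑ i ∈ S, l i * p i c) 0
  rw [rowSeq_sum] at h1
  simp only [mul_zero, Finset.sum_const_zero, zero_add, Pi.zero_apply, add_zero] at h1
  have h2 := rowSeq_add v 1 z (∑ i ∈ S, l i * 0) e'
    (fun c => ∑ i ∈ S, l i * rowSeq v (-v) z⁻¹ 0 (p i) c) (rowSeq v (-v) z⁻¹ e 0)
  rw [rowSeq_sum] at h2
  simp only [mul_zero, Finset.sum_const_zero, zero_add] at h2
  rw [doubleRow, h1, h2]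
  rfl

/-- The recursion for `lineSeq` with source `y ^ c` has the particular solution `x (1 - v) y ^ c /
(y - x)`; the homogeneous solution `x ^ c` absorbs the initial value. Three terms suffice: after its
first row, a double row has turned powers of `y` and `y⁻¹` into powers of `y`, `y⁻¹` and `z⁻¹`. -/
theorem rowSeq_geom (v b x e α₁ α₂ α₃ y₁ y₂ y₃ : ℂ) (h₁ : y₁ ≠ x) (h₂ : y₂ ≠ x) (h₃ : y₃ ≠ x) :
    rowSeq v b x e (fun c => α₁ * y₁ ^ c + α₂ * y₂ ^ c + α₃ * y₃ ^ c) = fun c =>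
      α₁ * (b + x * (1 - v) / (y₁ - x)) * y₁ ^ c + α₂ * (b + x * (1 - v) / (y₂ - x)) * y₂ ^ c +
      α₃ * (b + x * (1 - v) / (y₃ - x)) * y₃ ^ c +
      (e - x * (1 - v) * (α₁ / (y₁ - x) + α₂ / (y₂ - x) + α₃ / (y₃ - x))) * x ^ c := by
  have g₁ := sub_ne_zero.mpr h₁
  have g₂ := sub_ne_zero.mpr h₂
  have g₃ := sub_ne_zero.mpr h₃
  have hline : ∀ c, lineSeq v x e (fun c => α₁ * y₁ ^ c + α₂ * y₂ ^ c + α₃ * y₃ ^ c) c =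
      x * (1 - v) * (α₁ / (y₁ - x) * y₁ ^ c + α₂ / (y₂ - x) * y₂ ^ c + α₃ / (y₃ - x) * y₃ ^ c) +
      (e - x * (1 - v) * (α₁ / (y₁ - x) + α₂ / (y₂ - x) + α₃ / (y₃ - x))) * x ^ c := by
    intro c
    induction c with
    | zero =>
      simp only [lineSeq, pow_zero]
      ring
    | succ c ih =>
      have q : ∀ a y : ℂ, y - x ≠ 0 → a * y ^ c = a / (y - x) * (y * y ^ c - x * y ^ c) := by
        intro a y h
        field_simp
      simp only [lineSeq, ih, smul_eq_mul, pow_succ]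
      rw [q α₁ y₁ g₁, q α₂ y₂ g₂, q α₃ y₃ g₃]
      ring
  funext c
  rw [rowSeq, hline, smul_eq_mul]
  ring

/-- The normalized type `C₁` sequences, which are carried to combinations of themselves by
double rows. -/
noncomputable def capSeq (s y : ℂ) (c : ℕ) : ℂ :=
  (y ^ c * (y + s) - y⁻¹ ^ c * (y⁻¹ + s)) / (y - y⁻¹)

/-- The eigenvalue of the double row with parameter `z` at `y`. -/
noncomputable def doubleRowEigen (v y z : ℂ) : ℂ :=
  (1 - v * y * z) * (1 - v * z * y⁻¹) / (z * (y + y⁻¹ - (z + z⁻¹)))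

/-- The `Γ` and `Δ` factors of `y ^ c` are `(1 - v y z) / (y z - 1)` and `(y - v z) / (y - z)`.
Their product is invariant under `y ↦ y⁻¹`, so both powers in `capSeq s y` share one eigenvalue. The
powers of `z` and `z⁻¹` created on the way combine into `capSeq s z`. -/
theorem doubleRow_capSeq (v s y z : ℂ) (hy : y ≠ 0) (hz : z ≠ 0) (hy' : y - y⁻¹ ≠ 0)
    (hz' : z - z⁻¹ ≠ 0) (hyz : y + y⁻¹ - (z + z⁻¹) ≠ 0) (c : ℕ) :
    doubleRow v z 0 0 (capSeq s y) c = doubleRowEigen v y z * capSeq s y c +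
      (1 - v) * (v * z ^ 2 - 1) / (z * (y + y⁻¹ - (z + z⁻¹))) * capSeq s z c := by
  have hfac : y + y⁻¹ - (z + z⁻¹) = (y - z) * (y * z - 1) / (y * z) := by
    field_simp
    ring
  have hfac' : y - y⁻¹ = (y ^ 2 - 1) / y := by field_simp
  have hfac'' : z - z⁻¹ = (z ^ 2 - 1) / z := by field_simp
  have k1 : y - z ≠ 0 := fun h => hyz (by rw [hfac, h]; simp)
  have k2 : y * z - 1 ≠ 0 := fun h => hyz (by rw [hfac, h]; simp)
  have k3 : y ^ 2 - 1 ≠ 0 := fun h => hy' (by rw [hfac', h]; simp)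
  have k4 : z ^ 2 - 1 ≠ 0 := fun h => hz' (by rw [hfac'', h]; simp)
  have d1 : y - z⁻¹ = (y * z - 1) / z := by field_simp
  have d2 : y⁻¹ - z⁻¹ = -((y - z) / (y * z)) := by field_simp; ring
  have d3 : y⁻¹ - z = -((y * z - 1) / y) := by field_simp; ring
  have d4 : z⁻¹ - z = -((z ^ 2 - 1) / z) := by field_simp; ring
  -- The dummy term `0 * 0 ^ c` only fits the three-term form.
  have h0 : capSeq s y = fun c => (y + s) / (y - y⁻¹) * y ^ c +
      -((y⁻¹ + s) / (y - y⁻¹)) * y⁻¹ ^ c + 0 * 0 ^ c := by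
    funext c
    rw [capSeq]
    ring
  have e1 : y ≠ z⁻¹ := sub_ne_zero.mp (by rw [d1]; exact div_ne_zero k2 hz)
  have e2 : y⁻¹ ≠ z⁻¹ := sub_ne_zero.mp (by
    rw [d2]; exact neg_ne_zero.mpr (div_ne_zero k1 (mul_ne_zero hy hz)))
  have e3 : y⁻¹ ≠ z := sub_ne_zero.mp (by rw [d3]; exact neg_ne_zero.mpr (div_ne_zero k2 hy))
  have e4 : z⁻¹ ≠ z := sub_ne_zero.mp (by rw [d4]; exact neg_ne_zero.mpr (div_ne_zero k4 hz))
  rw [doubleRow, h0, rowSeq_geom _ _ _ _ _ _ _ _ _ _ e1 e2 (inv_ne_zero hz).symm]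
  simp only [zero_mul, add_zero, zero_div]
  rw [rowSeq_geom _ _ _ _ _ _ _ _ _ _ (sub_ne_zero.mp k1) e3 e4]
  simp only [capSeq, doubleRowEigen, hfac, hfac', hfac'', d1, d2, d3, d4]
  generalize y ^ c = Y
  generalize y⁻¹ ^ c = Y'
  generalize z ^ c = Z
  generalize z⁻¹ ^ c = Z'
  field_simp
  ring

/-- The relation `s ^ 2 = v` enters here, through `1 - v z² = (1 - s z) (1 + s z)`. -/
theorem doubleRow_zero (v s z w : ℂ) (hs : s ^ 2 = v) (hw : w ≠ 0) (hwz : w ^ 2 = z) (hz' : z - z⁻¹ ≠ 0) (c : ℕ) :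
    doubleRow v z w⁻¹ (-s * w) 0 c = w⁻¹ * (1 - s * z) * capSeq s z c := by
  subst hs
  have hz : z ≠ 0 := hwz ▸ pow_ne_zero 2 hw
  have hfac : z - z⁻¹ = (z ^ 2 - 1) / z := by field_simp
  have k : z ^ 2 - 1 ≠ 0 := fun h => hz' (by rw [hfac, h]; simp)
  have d : z⁻¹ - z = -((z ^ 2 - 1) / z) := by field_simp; ring
  have e : z⁻¹ ≠ z := sub_ne_zero.mp (by rw [d]; exact neg_ne_zero.mpr (div_ne_zero k hz))
  have h0 : (0 : ℕ → ℂ) = fun c => 0 * 0 ^ c + 0 * 0 ^ c + 0 * 0 ^ c := by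
    funext c
    simp
  have hsw : -s * w = -s * z * w⁻¹ := by
    rw [← hwz]
    field_simp
  have hi := (inv_ne_zero hz).symm
  rw [doubleRow, h0, rowSeq_geom _ _ _ _ _ _ _ _ _ _ hi hi hi]
  simp only [zero_mul, zero_div, add_zero, mul_zero, sub_zero, zero_add]
  have h1 : (fun c : ℕ => w⁻¹ * z⁻¹ ^ c) = fun c => w⁻¹ * z⁻¹ ^ c + 0 * z⁻¹ ^ c + 0 * z⁻¹ ^ c := by
    funext c
    ring
  rw [h1, rowSeq_geom _ _ _ _ _ _ _ _ _ _ e e e]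
  simp only [capSeq, hfac, d, hsw]
  generalize z ^ c = Z
  generalize z⁻¹ ^ c = Z'
  field_simp
  ring

theorem rowsSeq_two_mul_succ {r : ℕ} (v s : ℂ) (z w : Fin r → ℂ) (q : Fin r) (c : ℕ)
    (j : Fin r) :
    rowsSeq v (rowB v) (rowX z) (rowE s w) (2 * (q + 1)) c j =
      doubleRow v (z q) (if j = q then (w q)⁻¹ else 0) (if j = q then -s * w q else 0)
        (fun c => rowsSeq v (rowB v) (rowX z) (rowE s w) (2 * q) c j) c := by
  have hd : (2 * (q : ℕ) + 1) % 2 ≠ 0 := by omega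
  have hd' : (2 * (q : ℕ) + 1) / 2 = q := by omega
  have hg' : 2 * (q : ℕ) / 2 = q := by omega
  have hg : 2 * (q : ℕ) % 2 = 0 := by omega
  rw [show 2 * ((q : ℕ) + 1) = 2 * q + 1 + 1 by ring, rowsSeq, rowsSeq, rowSeq_apply]
  simp_rw [rowSeq_apply]
  rw [doubleRow]
  simp only [rowE, rowB, rowX, hd, hd', hg, hg', if_true, if_false, extendNat_val,
    unitVec_val, Pi.smul_apply, Pi.single_apply, smul_eq_mul, mul_ite, mul_one, mul_zero]

/-- Coordinate `j` stays zero until double row `j`, whose cap creates `capSeq s (z j)`. Each later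
double row multiplies that coefficient by an eigenvalue and otherwise adds only its own new
`capSeq`. This gives triangularity and the diagonal entries. -/
theorem exists_rowsSeq_eq_sum {r : ℕ} (v s : ℂ) (hs : s ^ 2 = v) (z w : Fin r → ℂ) (hw : ∀ i, w i ^ 2 = z i)
    (hz : ∀ i, z i ≠ 0) (hinv : ∀ i, z i - (z i)⁻¹ ≠ 0)
    (hne : ∀ i j, i < j → z i + (z i)⁻¹ - (z j + (z j)⁻¹) ≠ 0) (k : ℕ) (hk : k ≤ r) (j : Fin r) :
    ∃ l : Fin r → ℂ, (∀ i, i < j → l i = 0) ∧ (∀ i : Fin r, k ≤ i → l i = 0) ∧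
      ((j : ℕ) < k → l j = (w j)⁻¹ * (1 - s * z j) *
        ∏ i ∈ (Finset.Ioi j).filter (fun i : Fin r => (i : ℕ) < k), doubleRowEigen v (z j) (z i)) ∧
      ∀ c, rowsSeq v (rowB v) (rowX z) (rowE s w) (2 * k) c j = ∑ i, l i * capSeq s (z i) c := by
  induction k with
  | zero => exact ⟨0, by simp, by simp, by simp, by simp [rowsSeq]⟩
  | succ k ih =>
    obtain ⟨l, hl₁, hl₂, hl₃, hl₄⟩ := ih (by omega)
    obtain ⟨q, rfl⟩ : ∃ q : Fin r, (q : ℕ) = k := ⟨⟨k, hk⟩, rfl⟩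
    have hlq : ∀ i, q ≤ i → l i = 0 := fun i hi => hl₂ i hi
    have hl0 : ∀ i, q ≤ j → l i = 0 := fun i hi => by
      rcases lt_or_ge i j with h | h
      · exact hl₁ i h
      · exact hlq i (hi.trans h)
    set κ : Fin r → ℂ := fun i => (1 - v) * (v * z q ^ 2 - 1) /
      (z q * (z i + (z i)⁻¹ - (z q + (z q)⁻¹)))
    -- The new coefficient at `q` collects the `capSeq s (z q)` terms shed by all earlier sequences,
    -- plus the cap's own contribution when `j = q`.
    refine ⟨fun i => (if i = q then ((∑ i', l i' * κ i') +
      if j = q then (w q)⁻¹ * (1 - s * z q) else 0) else l i * doubleRowEigen v (z i) (z q)),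
      fun i hi => ?_, fun i hi => ?_, fun hj => ?_, fun c => ?_⟩
    · by_cases h : i = q
      · subst h
        simp [hl0 _ hi.le, hi.ne']
      · simp [h, hl₁ i hi]
    · have h : i ≠ q := by rintro rfl; omega
      simp [h, hlq i (by rw [Fin.le_def]; omega)]
    · by_cases h : j = q
      · subst h
        rw [Finset.filter_false_of_mem (by
          intro i hi
          have : j < i := Finset.mem_Ioi.mp hi
          rw [Fin.lt_def] at this
          omega)]
        simp [hl0 _ le_rfl]
      · have hjq : (j : ℕ) < q := lt_of_le_of_ne (by omega) fun h' => h (Fin.ext h')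
        have hfil : (Finset.Ioi j).filter (fun i : Fin r => (i : ℕ) < q + 1) =
            insert q ((Finset.Ioi j).filter (fun i : Fin r => (i : ℕ) < q)) := by
          ext i
          simp only [Finset.mem_filter, Finset.mem_Ioi, Finset.mem_insert, Fin.lt_def, Fin.ext_iff]
          omega
        rw [hfil, Finset.prod_insert (by simp)]
        simp only [h, if_false, hl₃ hjq]
        ring
    · rw [rowsSeq_two_mul_succ, funext hl₄, doubleRow_add_sum]
      have hz0 : doubleRow v (z q) (if j = q then (w q)⁻¹ else 0) (if j = q then -s * w q else 0)
          0 c = (if j = q then (w q)⁻¹ * (1 - s * z q) else 0) * capSeq s (z q) c := by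
        by_cases h : j = q
        · simp only [h, if_true]
          refine doubleRow_zero v s (z q) (w q) hs ?_ (hw q) (hinv q) c
          intro h0
          exact hz q (by rw [← hw q, h0]; simp)
        · simp only [h, if_false, zero_mul, doubleRow, rowSeq_zero, Pi.zero_apply]
      have hterm : ∀ i, l i * doubleRow v (z q) 0 0 (capSeq s (z i)) c =
          (l i * doubleRowEigen v (z i) (z q)) * capSeq s (z i) c +
            l i * κ i * capSeq s (z q) c := by
        intro i
        rcases lt_or_ge i q with h | h
        · rw [doubleRow_capSeq v s (z i) (z q) (hz i) (hz q) (hinv i) (hinv q) (hne i q h)]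
          ring
        · simp [hlq i h]
      have hsplit : ∀ i, (if i = q then ((∑ i', l i' * κ i') +
          if j = q then (w q)⁻¹ * (1 - s * z q) else 0) else
            l i * doubleRowEigen v (z i) (z q)) * capSeq s (z i) c =
          l i * doubleRowEigen v (z i) (z q) * capSeq s (z i) c +
          if i = q then ((∑ i', l i' * κ i') +
            if j = q then (w q)⁻¹ * (1 - s * z q) else 0) * capSeq s (z q) c else 0 := by
        intro i
        by_cases h : i = q
        · simp [h, hlq q le_rfl]
        · simp [h]
      rw [hz0, Finset.sum_congr rfl fun i _ => hterm i, Finset.sum_congr rfl fun i _ => hsplit i,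
        Finset.sum_add_distrib, Finset.sum_add_distrib, Finset.sum_ite_eq' Finset.univ q,
        if_pos (Finset.mem_univ q), add_mul, Finset.sum_mul, add_assoc]

theorem partitionFunction_eq_det_capSeq {r : ℕ} [NeZero r] (lam : Fin r → ℕ) (hlam : Antitone lam)
    (v s : ℂ) (hs : s ^ 2 = v) (z w : Fin r → ℂ) (hw : ∀ i, w i ^ 2 = z i) (hz : ∀ i, z i ≠ 0)
    (hinv : ∀ i, z i - (z i)⁻¹ ≠ 0)
    (hne : ∀ i j, i < j → z i + (z i)⁻¹ - (z j + (z j)⁻¹) ≠ 0) :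
    partitionFunction lam v s z w =
      (∏ i, ((w i)⁻¹ * (1 - s * z i) * ∏ j ∈ Finset.Ioi i, doubleRowEigen v (z i) (z j))) *
      Matrix.det (Matrix.of fun m i : Fin r => capSeq s (z i) (lam m + r - (m + 1))) := by
  choose l hl₁ _ hl₃ hl₄ using exists_rowsSeq_eq_sum v s hs z w hw hz hinv hne r le_rfl
  have hmul : (Matrix.of fun m : Fin r =>
      rowsSeq v (rowB v) (rowX z) (rowE s w) (2 * r) (lam m + r - (m + 1))) =
      (Matrix.of fun m i : Fin r => capSeq s (z i) (lam m + r - (m + 1))) *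
        (Matrix.of l).transpose := by
    ext m j
    rw [Matrix.of_apply, hl₄, Matrix.mul_apply]
    exact Finset.sum_congr rfl fun i _ => mul_comm _ _
  have htri : (Matrix.of l).IsUpperTriangular := fun i j hij => hl₁ i j hij
  rw [partitionFunction_eq_det lam hlam, hmul, Matrix.det_mul, Matrix.det_transpose,
    Matrix.det_of_isUpperTriangular htri, mul_comm]
  congr 1
  refine Finset.prod_congr rfl fun i _ => ?_
  rw [Matrix.of_apply, hl₃ i i.isLt, Finset.filter_true_of_mem fun j _ => j.isLt]

/-! ### The Weyl denominator and the sum over the hyperoctahedral group. -/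

theorem weylDenomC_eq_add_inv {r : ℕ} (z : Fin r → ℂ) (hz : ∀ i, z i ≠ 0) :
    weylDenomC z = (∏ i : Fin r, ∏ j ∈ Finset.Ioi i, (z i + (z i)⁻¹ - (z j + (z j)⁻¹))) *
      ∏ i : Fin r, (z i - (z i)⁻¹) := by
  have hsq : ∀ i, (z i ^ (1 / 2 : ℂ)) ^ 2 = z i := fun i => by
    rw [← Complex.cpow_nat_mul]; norm_num
  have hne : ∀ i, z i ^ (1 / 2 : ℂ) ≠ 0 := fun i h => hz i (by rw [← hsq i, h]; simp)
  have key : ∀ a b : ℂ, a ≠ 0 → b ≠ 0 →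
      (a * b⁻¹ - a⁻¹ * b) * (a * b - a⁻¹ * b⁻¹) =
        a ^ 2 + (a ^ 2)⁻¹ - (b ^ 2 + (b ^ 2)⁻¹) := by
    intro a b ha hb
    field_simp
    ring
  rw [weylDenomC_eq z _ hz hsq]
  congr 1
  refine Finset.prod_congr rfl fun i _ => Finset.prod_congr rfl fun j _ => ?_
  rw [key _ _ (hne i) (hne j), hsq, hsq]

theorem prod_sub_comp_perm {r : ℕ} (X : Fin r → ℂ) (π : Equiv.Perm (Fin r)) :
    ∏ i : Fin r, ∏ j ∈ Finset.Ioi i, (X (π i) - X (π j)) =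
      Equiv.Perm.sign π * ∏ i : Fin r, ∏ j ∈ Finset.Ioi i, (X i - X j) := by
  -- `Matrix.det_vandermonde` has factors with the later index first, hence the sign change of `Y`.
  have h : ∀ Y : Fin r → ℂ, ∏ i : Fin r, ∏ j ∈ Finset.Ioi i, (Y i - Y j) =
      Matrix.det (Matrix.vandermonde fun i => -Y i) := by
    intro Y
    rw [Matrix.det_vandermonde]
    exact Finset.prod_congr rfl fun i _ => Finset.prod_congr rfl fun j _ => by ring
  rw [h X, h fun i => X (π i), ← Matrix.det_permute]
  rfl

/-- The involution exchanging `i` and its bar for all `i` with `ε i`. -/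
def flipPerm {r : ℕ} (ε : Fin r → Bool) : Equiv.Perm (SignedIndex r) where
  toFun := Sum.elim (fun i => if ε i then Sum.inr i else Sum.inl i)
    fun i => if ε i then Sum.inl i else Sum.inr i
  invFun := Sum.elim (fun i => if ε i then Sum.inr i else Sum.inl i)
    fun i => if ε i then Sum.inl i else Sum.inr i
  left_inv := by rintro (i | i) <;> by_cases h : ε i <;> simp [h]
  right_inv := by rintro (i | i) <;> by_cases h : ε i <;> simp [h]

/-- The signed permutation sending `i` to `π i` or, if `ε i`, to its bar. -/
def signedPerm {r : ℕ} (x : Equiv.Perm (Fin r) × (Fin r → Bool)) : hyperoctahedral r :=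
  ⟨(flipPerm x.2).trans (Equiv.sumCongr x.1 x.1), by
    rintro (i | i) <;> by_cases h : x.2 i <;> simp [flipPerm, h, bar]⟩

theorem signedPerm_inl {r : ℕ} (x : Equiv.Perm (Fin r) × (Fin r → Bool)) (i : Fin r) :
    (signedPerm x : Equiv.Perm (SignedIndex r)) (Sum.inl i) =
      if x.2 i then Sum.inr (x.1 i) else Sum.inl (x.1 i) := by
  by_cases h : x.2 i <;> simp [signedPerm, flipPerm, h]

theorem signedPerm_bijective (r : ℕ) : Function.Bijective (signedPerm (r := r)) := by
  constructor
  · rintro ⟨π, ε⟩ ⟨π', ε'⟩ h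
    have h' : ∀ i, (if ε i then Sum.inr (π i) else Sum.inl (π i) : SignedIndex r) =
        if ε' i then Sum.inr (π' i) else Sum.inl (π' i) := fun i => by
      rw [← signedPerm_inl (π, ε), ← signedPerm_inl (π', ε'), h]
    have h'' : ∀ i, π i = π' i ∧ ε i = ε' i := fun i => by
      have := h' i
      cases h1 : ε i <;> cases h2 : ε' i <;> simp_all
    exact Prod.ext (Equiv.ext fun i => (h'' i).1) (funext fun i => (h'' i).2)
  · rintro ⟨σ, hσ⟩
    have hσ' : ∀ x, σ (Sum.swap x) = Sum.swap (σ x) := hσ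
    -- If two images agree up to bar, they are equal or bars of each other; the latter would make an
    -- unbarred index the bar of another.
    have hinj : Function.Injective fun i => Sum.elim id id (σ (Sum.inl i)) := by
      intro i j hij
      have h : σ (Sum.inl i) = σ (Sum.inl j) ∨ σ (Sum.inl i) = Sum.swap (σ (Sum.inl j)) := by
        dsimp only at hij
        generalize σ (Sum.inl i) = A at hij ⊢
        generalize σ (Sum.inl j) = B at hij ⊢
        rcases A with a | a <;> rcases B with b | b <;> simpa using hij
      rcases h with h | h
      · exact Sum.inl_injective (σ.injective h)
      · rw [← hσ'] at h
        exact absurd (σ.injective h) (by simp)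
    refine ⟨(Equiv.ofBijective _ (Finite.injective_iff_bijective.mp hinj),
      fun i => (σ (Sum.inl i)).isRight), ?_⟩
    have hl : ∀ i, (signedPerm (Equiv.ofBijective _ (Finite.injective_iff_bijective.mp hinj),
        fun i => (σ (Sum.inl i)).isRight) : Equiv.Perm (SignedIndex r)) (Sum.inl i) =
          σ (Sum.inl i) := by
      intro i
      rw [signedPerm_inl]
      simp only [Equiv.ofBijective_apply]
      rcases σ (Sum.inl i) with a | a <;> simp
    refine Subtype.ext (Equiv.ext fun x => ?_)
    rcases x with i | i
    · exact hl i
    · have := (signedPerm (Equiv.ofBijective _ (Finite.injective_iff_bijective.mp hinj),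
        fun i => (σ (Sum.inl i)).isRight)).2 (Sum.inl i)
      simp only [bar, Sum.swap_inl] at this
      rw [this, hl, ← hσ', Sum.swap_inl]

theorem act_signedPerm {r : ℕ} (x : Equiv.Perm (Fin r) × (Fin r → Bool)) (z : Fin r → ℂ)
    (i : Fin r) : act (signedPerm x) z i = if x.2 i then (z (x.1 i))⁻¹ else z (x.1 i) := by
  rw [act, signedPerm_inl]
  split_ifs <;> simp [signedExt]

/-- Inversions fix each `z i + (z i)⁻¹`, so the Vandermonde factor sees only the sign of the
permutation, while each inversion negates one factor `z i - (z i)⁻¹`. -/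
theorem weylDenomC_act {r : ℕ} (x : Equiv.Perm (Fin r) × (Fin r → Bool)) (z : Fin r → ℂ)
    (hz : ∀ i, z i ≠ 0) :
    weylDenomC (act (signedPerm x) z) =
      Equiv.Perm.sign x.1 * (∏ i, if x.2 i then (-1 : ℂ) else 1) * weylDenomC z := by
  have hX : ∀ i, act (signedPerm x) z i + (act (signedPerm x) z i)⁻¹ =
      z (x.1 i) + (z (x.1 i))⁻¹ := fun i => by
    rw [act_signedPerm]
    split_ifs
    · rw [inv_inv, add_comm]
    · rfl
  have hY : ∀ i, act (signedPerm x) z i - (act (signedPerm x) z i)⁻¹ =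
      (if x.2 i then (-1 : ℂ) else 1) * (z (x.1 i) - (z (x.1 i))⁻¹) := fun i => by
    rw [act_signedPerm]
    split_ifs
    · rw [inv_inv]
      ring
    · ring
  rw [weylDenomC_eq_add_inv z hz, weylDenomC_eq_add_inv _ fun i => by
    rw [act_signedPerm]; split_ifs <;> simp [hz]]
  simp_rw [hX, hY]
  rw [prod_sub_comp_perm (fun i => z i + (z i)⁻¹) x.1, Finset.prod_mul_distrib,
    Equiv.prod_comp x.1 fun i => z i - (z i)⁻¹]
  ring

/-- The sum over the hyperoctahedral group as a quotient of determinants. -/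
theorem sum_summand_act {r : ℕ} (lam : Fin r → ℕ) (s : ℂ) (z : Fin r → ℂ) (hz : ∀ i, z i ≠ 0) :
    ∑ σ : hyperoctahedral r, summand lam s (act σ z) =
      (weylDenomC z)⁻¹ * Matrix.det (Matrix.of fun m i : Fin r =>
        z i ^ (lam m + (r - m)) * (1 + s * (z i)⁻¹) -
          (z i)⁻¹ ^ (lam m + (r - m)) * (1 + s * z i)) := by
  rw [← (Equiv.ofBijective _ (signedPerm_bijective r)).sum_comp, Fintype.sum_prod_type,
    ← Matrix.det_transpose, Matrix.det_apply', Finset.mul_sum]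
  refine Finset.sum_congr rfl fun π _ => ?_
  have hb : ∀ i : Fin r, (Matrix.of fun m i : Fin r =>
        z i ^ (lam m + (r - m)) * (1 + s * (z i)⁻¹) -
          (z i)⁻¹ ^ (lam m + (r - m)) * (1 + s * z i)).transpose (π i) i =
      ∑ b : Bool, (if b then (-1 : ℂ) else 1) *
        ((if b then (z (π i))⁻¹ else z (π i)) ^ (lam i + (r - i)) *
          (1 + s * (if b then (z (π i))⁻¹ else z (π i))⁻¹)) := by
    intro i
    simp
    ring
  -- Each matrix entry is a signed sum over inverting `z` or not; expanding the product of these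
  -- sums yields the sign choices `ε`.
  rw [Finset.prod_congr rfl fun i _ => hb i, Fintype.prod_sum, Finset.mul_sum, Finset.mul_sum]
  refine Finset.sum_congr rfl fun ε _ => ?_
  rw [Equiv.ofBijective_apply, summand, weylDenomC_act _ _ hz]
  simp_rw [act_signedPerm]
  have hs1 : ((Equiv.Perm.sign π : ℤ) : ℂ)⁻¹ = (Equiv.Perm.sign π : ℤ) := by
    rcases Int.units_eq_one_or (Equiv.Perm.sign π) with h | h <;> simp [h]
  have hs2 : (∏ i, if ε i then (-1 : ℂ) else 1)⁻¹ = ∏ i, if ε i then (-1 : ℂ) else 1 := by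
    rw [← Finset.prod_inv_distrib]
    refine Finset.prod_congr rfl fun i _ => ?_
    split_ifs <;> simp
  simp only [Finset.prod_mul_distrib, mul_inv, hs1, hs2]
  ring

end UTurnIce

/-- The factor `∏ i, w i ^ (-(2 * i + 1))` is `z^{-ρ_B}` for `ρ_B = (1/2, 3/2, …, r - 1/2)`. -/
theorem theorem2 (r : ℕ) [NeZero r] (lam : Fin r → ℕ) (hlam : Antitone lam)
    (v s : ℂ) (hs : s ^ 2 = v)
    (z w : Fin r → ℂ) (hw : ∀ i, w i ^ 2 = z i) (hz : ∀ i, z i ≠ 0)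
    (hden : UTurnIce.weylDenomC z ≠ 0) :
    UTurnIce.partitionFunction lam v s z w =
      (∏ i : Fin r, w i ^ (-(2 * ((i : ℕ) : ℤ) + 1))) *
      (∏ i : Fin r, (1 - s * z i)) *
      (∏ i : Fin r, ∏ j ∈ Finset.Ioi i, ((1 - v * z i * z j) * (1 - v * z j * (z i)⁻¹))) *
      ∑ σ : UTurnIce.hyperoctahedral r, UTurnIce.summand lam s (UTurnIce.act σ z) := by
  open UTurnIce in
  have hD := weylDenomC_eq_add_inv z hz
  have hw0 : ∀ i, w i ≠ 0 := fun i h => hz i (by rw [← hw i, h]; simp)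
  have hinv : ∀ i, z i - (z i)⁻¹ ≠ 0 := fun i =>
    Finset.prod_ne_zero_iff.mp (right_ne_zero_of_mul (hD ▸ hden)) i (Finset.mem_univ i)
  have hne : ∀ i j, i < j → z i + (z i)⁻¹ - (z j + (z j)⁻¹) ≠ 0 := fun i j hij =>
    Finset.prod_ne_zero_iff.mp (Finset.prod_ne_zero_iff.mp
      (left_ne_zero_of_mul (hD ▸ hden)) i (Finset.mem_univ i)) j (Finset.mem_Ioi.mpr hij)
  have hdet : Matrix.det (Matrix.of fun m i : Fin r => capSeq s (z i) (lam m + r - (m + 1))) =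
      (∏ i, (z i - (z i)⁻¹)⁻¹) * Matrix.det (Matrix.of fun m i : Fin r =>
        z i ^ (lam m + (r - m)) * (1 + s * (z i)⁻¹) -
          (z i)⁻¹ ^ (lam m + (r - m)) * (1 + s * z i)) := by
    rw [← Matrix.det_mul_row]
    congr 1
    ext m i
    have hexp : lam m + (r - (m : ℕ)) = lam m + r - (m + 1) + 1 := by
      have := m.isLt
      omega
    have h0 := hz i
    rw [Matrix.of_apply, Matrix.of_apply, Matrix.of_apply, hexp, capSeq, pow_succ, pow_succ,
      div_eq_inv_mul]
    congr 1
    field_simp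
  -- The `1 / z` in each eigenvalue contributes `(z j)⁻¹` once for every `i < j`; together with the
  -- cap factors `(w j)⁻¹` this makes up `z^{-ρ_B}`.
  have hpow : ∏ i : Fin r, ∏ j ∈ Finset.Ioi i, (z j)⁻¹ = ∏ i : Fin r, (z i ^ (i : ℕ))⁻¹ := by
    rw [Finset.prod_comm' (t' := Finset.univ) (s' := fun j => Finset.Iio j) (by simp)]
    refine Finset.prod_congr rfl fun j _ => ?_
    rw [Finset.prod_const, Fin.card_Iio, inv_pow]
  have hwpow : ∀ i : Fin r, w i ^ (-(2 * ((i : ℕ) : ℤ) + 1)) = (w i)⁻¹ * (z i ^ (i : ℕ))⁻¹ := by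
    intro i
    rw [← hw i, ← pow_mul, zpow_neg, zpow_add₀ (hw0 i), zpow_one, mul_inv, mul_comm]
    norm_cast
  have heig : ∏ i : Fin r, ∏ j ∈ Finset.Ioi i, doubleRowEigen v (z i) (z j) =
      (∏ i : Fin r, ∏ j ∈ Finset.Ioi i, ((1 - v * z i * z j) * (1 - v * z j * (z i)⁻¹))) *
      (∏ i : Fin r, (z i ^ (i : ℕ))⁻¹) *
      (∏ i : Fin r, ∏ j ∈ Finset.Ioi i, (z i + (z i)⁻¹ - (z j + (z j)⁻¹)))⁻¹ := by
    rw [← hpow]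
    simp only [← Finset.prod_mul_distrib, ← Finset.prod_inv_distrib]
    refine Finset.prod_congr rfl fun i _ => Finset.prod_congr rfl fun j _ => ?_
    rw [doubleRowEigen, div_eq_mul_inv, mul_inv]
    ring
  rw [partitionFunction_eq_det_capSeq lam hlam v s hs z w hw hz hinv hne, sum_summand_act _ _ _ hz,
    hdet, hD, Finset.prod_mul_distrib, Finset.prod_mul_distrib, heig,
    Finset.prod_congr rfl fun i _ => hwpow i, Finset.prod_mul_distrib, mul_inv,
    Finset.prod_inv_distrib (f := fun i => z i - (z i)⁻¹)]
  ring
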